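/- A standard probability space is a standard Borel space with a probability measure. An action of a countable group $\Gamma$ on a standard probability space $(X,\mu)$ is an action by Borel automorphisms that is non-singular (every $s\in\Gamma$ preserves the $\mu$-null sets); it is essentially free if $\mu(\{x\in X : sx=x\})=0$ for all $s\in\Gamma\setminus\{e\}$. A factor map $\pi\colon (Y,\nu)\to(X,\mu)$ between two such actions is a measurable map such that $\pi_*\nu$ and $\mu$ have the same null sets and, for every $s\in\Gamma$, $\pi(sy)=s\pi(y)$ for $\nu$-a.e. $y\in Y$. An intermediate extension of $\pi$ consists of an action of $\Gamma$ on a standard probability space $(Z,\zeta)$ and factor maps $p\colon Y\to Z$, $q\colon Z\to X$ with $q\circ p=\pi$ a.e. Via $f\mapsto f\circ\pi$ and $f\mapsto f\circ p$ one regards $L^\infty(X)\subset L^\infty(Z)\subset L^\infty(Y)$ as $\Gamma$-invariant von Neumann subalgebras. The crossed product $L^\infty(Y)\rtimes\Gamma$ is the von Neumann algebra on $\ell^2(\Gamma)\otimes L^2(Y,\nu)$ generated by the operators $(g\xi)(t,y)=g(ty)\,\xi(t,y)$, $g\in L^\infty(Y)$, and the unitaries $(u_s\xi)(t,y)=\xi(s^{-1}t,y)$,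 $s\in\Gamma$; for a $\Gamma$-invariant von Neumann subalgebra $N\subset L^\infty(Y)$, $N\rtimes\Gamma\subset L^\infty(Y)\rtimes\Gamma$ is the von Neumann subalgebra generated by $N$ and $\{u_s : s\in\Gamma\}$. \textbf{Proposition.} Let $\Gamma$ be a countable group and let $\alpha\colon\Gamma\curvearrowright(X,\mu)$ be a (non-singular) action on a standard probability space which is not essentially free. Then there are an essentially free (non-singular) action $\beta\colon\Gamma\curvearrowright(Y,\nu)$ on a standard probability space and a factor map $\pi\colon Y\to X$ with the following property: there is a von Neumann algebra $M$ with \[ L^\infty(X)\rtimes\Gamma\subset M\subset L^\infty(Y)\rtimes\Gamma \] such that $M\neq L^\infty(Z)\rtimes\Gamma$ for every intermediate extension $Z$ of $\pi$. -/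

import Mathlib

open MeasureTheory
open scoped ENNReal

universe u v w

noncomputable section

namespace CrossedProduct

/-! ### Measurable dynamics

A standard probability space is a standard Borel space with a probability measure.  All statements
about maps between such spaces are up to null sets. -/

/-- The action of `Γ` on `(X, μ)` is non-singular: each group element acts by a measurable map
preserving null sets under preimages (applied to `s` and `s⁻¹`, this says that every `s` acts by a
Borel isomorphism preserving the class of `μ`). -/
def IsNonsingular (Γ : Type u) {X : Type v} [Group Γ] [MulAction Γ X] [MeasurableSpace X]
    (μ : Measure X) : Prop :=
  ∀ s : Γ, Measure.QuasiMeasurePreserving (fun x : X => s • x) μ μ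

/-- The action of `Γ` on `(X, μ)` is essentially free: every non-trivial group element has a null
set of fixed points. -/
def IsEssentiallyFree (Γ : Type u) {X : Type v} [Group Γ] [MulAction Γ X] [MeasurableSpace X]
    (μ : Measure X) : Prop :=
  ∀ s : Γ, s ≠ 1 → μ {x : X | s • x = x} = 0

/-- `π : (Y, ν) → (X, μ)` is a factor map: it is measurable, preserves the measure class
(`π_* ν` and `μ` have the same null sets), and is `Γ`-equivariant up to null sets. -/
structure IsFactorMap (Γ : Type u) {Y : Type v} {X : Type w} [Group Γ]
    [MulAction Γ Y] [MulAction Γ X] [MeasurableSpace Y] [MeasurableSpace X]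
    (π : Y → X) (ν : Measure Y) (μ : Measure X) : Prop where
  measurable : Measurable π
  map_absolutelyContinuous : ν.map π ≪ μ
  absolutelyContinuous_map : μ ≪ ν.map π
  equivariant : ∀ s : Γ, ∀ᵐ y ∂ν, π (s • y) = s • π y

/-! ### Crossed product von Neumann algebras -/

/-- The von Neumann algebra on `H` generated by a set `S` of bounded operators: the bicommutant of
`S ∪ S*`. -/
def generated {H : Type u} [NormedAddCommGroup H] [InnerProductSpace ℂ H] [CompleteSpace H]
    (S : Set (H →L[ℂ] H)) : VonNeumannAlgebra H where
  toStarSubalgebra :=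
    StarSubalgebra.centralizer ℂ (StarSubalgebra.centralizer ℂ S : Set (H →L[ℂ] H))
  centralizer_centralizer' := by
    have h : (StarSubalgebra.centralizer ℂ
        (StarSubalgebra.centralizer ℂ S : Set (H →L[ℂ] H))).carrier
        = Set.centralizer (Set.centralizer (S ∪ star S)) :=
      StarSubalgebra.coe_centralizer_centralizer ℂ S
    rw [h, Set.centralizer_centralizer_centralizer]

/-- The multiplication operator `ξ ↦ F ξ` on `L²(Ω, m)` for `F ∈ L^∞(Ω, m)`. -/
def mulOp {Ω : Type u} [MeasurableSpace Ω] {m : Measure Ω} (F : Lp ℂ ∞ m) :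
    Lp ℂ 2 m →L[ℂ] Lp ℂ 2 m :=
  (ContinuousLinearMap.mul ℂ ℂ).holderL m ∞ 2 2 F

variable (Γ : Type u) {Y : Type v} {Z : Type w}

/-- The Hilbert space `ℓ²(Γ) ⊗ L²(Y, ν)`, realised as `L²(Γ × Y)` with respect to the product of the
counting measure and `ν`. -/
abbrev HilbertSpace [MeasurableSpace Γ] [MeasurableSpace Y] (ν : Measure Y) : Type (max u v) :=
  Lp ℂ 2 ((Measure.count : Measure Γ).prod ν)

/-- The set of operators `ξ ↦ ((t, y) ↦ g (t • y) ξ (t, y))` on `L²(Γ × Y)`, with `g ∈ N`.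
As `g (t • y) = (β_{t⁻¹} g) (y)`, this is the image of `N ⊆ L^∞(Y)` under the usual regular
representation `(π_β(g) ξ)(t) = β_{t⁻¹}(g) ξ(t)`. -/
def coefficientOps [Group Γ] [MeasurableSpace Γ] [MeasurableSpace Y] [MulAction Γ Y]
    (ν : Measure Y) (N : Set (Lp ℂ ∞ ν)) :
    Set (HilbertSpace Γ ν →L[ℂ] HilbertSpace Γ ν) :=
  {T | ∃ g ∈ N, ∃ F : Lp ℂ ∞ ((Measure.count : Measure Γ).prod ν),
    (F =ᵐ[(Measure.count : Measure Γ).prod ν] fun z : Γ × Y => g (z.1 • z.2)) ∧ T = mulOp F}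

theorem measurePreserving_translate {Γ : Type u} [Group Γ] [Countable Γ] [MeasurableSpace Γ]
    [DiscreteMeasurableSpace Γ] [MeasurableSpace Y] (ν : Measure Y) [SFinite ν] (s : Γ) :
    MeasurePreserving (fun z : Γ × Y => (s⁻¹ * z.1, z.2))
      ((Measure.count : Measure Γ).prod ν) ((Measure.count : Measure Γ).prod ν) :=
  (measurePreserving_mul_left (Measure.count : Measure Γ) s⁻¹).prod (MeasurePreserving.id ν)

/-- The implementing unitary `u_s = λ_s ⊗ 1`: `(u_s ξ)(t, y) = ξ(s⁻¹ t, y)`. -/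
def translationOp {Γ : Type u} [Group Γ] [Countable Γ] [MeasurableSpace Γ]
    [DiscreteMeasurableSpace Γ] [MeasurableSpace Y] (ν : Measure Y) [SFinite ν] (s : Γ) :
    HilbertSpace Γ ν →L[ℂ] HilbertSpace Γ ν :=
  (Lp.compMeasurePreservingₗᵢ ℂ (fun z : Γ × Y => (s⁻¹ * z.1, z.2))
    (measurePreserving_translate ν s)).toContinuousLinearMap

/-- The crossed product `N ⋊ Γ` of a `Γ`-invariant von Neumann subalgebra `N ⊆ L^∞(Y, ν)`, as a von
Neumann subalgebra of `L^∞(Y, ν) ⋊ Γ` acting on `ℓ²(Γ) ⊗ L²(Y, ν)`: it is generated by the copy of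
`N` and the implementing unitaries. -/
def crossedProduct [Group Γ] [Countable Γ] [MeasurableSpace Γ] [DiscreteMeasurableSpace Γ]
    [MeasurableSpace Y] [MulAction Γ Y] (ν : Measure Y) [SFinite ν] (N : Set (Lp ℂ ∞ ν)) :
    VonNeumannAlgebra (HilbertSpace Γ ν) :=
  generated (coefficientOps Γ ν N ∪ Set.range (translationOp (Γ := Γ) ν))

/-- `L^∞(Z, ζ)` regarded as a subalgebra of `L^∞(Y, ν)` via `p : Y → Z`, that is `{f ∘ p}`. -/
def pullbackLinfty [MeasurableSpace Y] [MeasurableSpace Z] (ν : Measure Y) (ζ : Measure Z)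
    (p : Y → Z) : Set (Lp ℂ ∞ ν) :=
  {g | ∃ f : Lp ℂ ∞ ζ, g =ᵐ[ν] fun y => f (p y)}

end CrossedProduct

end

open CrossedProduct

/-!
Let `s ≠ 1` fix a set of positive measure, and let `Y = X × Γ × {0, 1}` with the diagonal action,
trivial on `{0, 1}`. Over the set `D` of the points `(x, y)` with `y s y⁻¹ x = x`, let `T` exchange
the two sheets, and let `T'` exchange the two sheets while multiplying the `Γ`-coordinate of `Γ × Y`
on the right by `y s^{±1} y⁻¹`; off `D`, both are the identity. Both commute with `L^∞(X) ⋊ Γ`.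

If `J` is a permutation of `Γ` with `J (z s) = J (z) s⁻¹`, the full group of `Γ ↷ Y` contains a
unitary `V`, sending `(t, x, y, i)` to `(J (t y) s^i y⁻¹, x, y, i)`, which conjugates `T` and `T'`
into each other. Hence `M = ⟨L^∞(X) ⋊ Γ, V⟩` commutes with `T + T'`, but not with `T`. Now `T`
preserves the fibres of `Γ × Y → Γ`, and `T'` leaves them over `D`, so a multiplication operator
commuting with `T + T'` commutes with `T` already. If `M` were of the form `N ⋊ Γ`, it would
therefore commute with `T`.
-/

noncomputable section

namespace CrossedProduct

/-! ### Generated von Neumann algebras -/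

section Generated

variable {H : Type*} [NormedAddCommGroup H] [InnerProductSpace ℂ H] [CompleteSpace H]
  {S : Set (H →L[ℂ] H)} {M : VonNeumannAlgebra H}

theorem mem_generated_iff {x : H →L[ℂ] H} :
    x ∈ generated S ↔ ∀ V ∈ StarSubalgebra.centralizer ℂ S, Commute V x := by
  change x ∈ StarSubalgebra.centralizer ℂ (StarSubalgebra.centralizer ℂ S : Set (H →L[ℂ] H)) ↔ _
  rw [StarSubalgebra.mem_centralizer_iff]
  exact ⟨fun h V hV => (h V hV).1, fun h V hV => ⟨h V hV, h _ (star_mem hV)⟩⟩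

theorem subset_generated (S : Set (H →L[ℂ] H)) : S ⊆ generated S := fun _ hx =>
  mem_generated_iff.2 fun _ hV => ((StarSubalgebra.mem_centralizer_iff ℂ).1 hV _ hx).1.symm

theorem generated_le (h : S ⊆ M) : generated S ≤ M := by
  intro x hx
  rw [← M.commutant_commutant, VonNeumannAlgebra.mem_commutant_iff]
  intro V hV
  rw [VonNeumannAlgebra.mem_commutant_iff] at hV
  exact mem_generated_iff.1 hx V <| (StarSubalgebra.mem_centralizer_iff ℂ).2 fun g hg =>
    ⟨hV g (h hg), hV _ (star_mem (h hg))⟩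

theorem commute_of_mem_generated {T x : H →L[ℂ] H} (hT : IsSelfAdjoint T)
    (h : ∀ g ∈ S, Commute T g) (hx : x ∈ generated S) : Commute T x := by
  refine mem_generated_iff.1 hx T <| (StarSubalgebra.mem_centralizer_iff ℂ).2 fun g hg =>
    ⟨(h g hg).symm, ?_⟩
  have hstar : Commute T (star g) := by
    rw [← commute_star_comm, hT.star_eq]
    exact h g hg
  exact hstar.symm

end Generated

/-! ### Composition and multiplication operators -/

section Operators

variable {Ω : Type*} [MeasurableSpace Ω] {m : Measure Ω}

/-- The composition operator `ξ ↦ ξ ∘ θ` on `L²(Ω, m)` for a measure preserving map `θ`. -/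
def compOp {θ : Ω → Ω} (hθ : MeasurePreserving θ m m) : Lp ℂ 2 m →L[ℂ] Lp ℂ 2 m :=
  (Lp.compMeasurePreservingₗᵢ ℂ θ hθ).toContinuousLinearMap

variable {θ η θ' η' : Ω → Ω} (hθ : MeasurePreserving θ m m) (hη : MeasurePreserving η m m)
  (hθ' : MeasurePreserving θ' m m) (hη' : MeasurePreserving η' m m)

theorem coeFn_compOp (ξ : Lp ℂ 2 m) : compOp hθ ξ =ᵐ[m] fun z => ξ (θ z) :=
  Lp.coeFn_compMeasurePreserving ξ hθ

theorem coeFn_mulOp (F : Lp ℂ ∞ m) (ξ : Lp ℂ 2 m) : mulOp F ξ =ᵐ[m] fun z => F z * ξ z :=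
  (ContinuousLinearMap.mul ℂ ℂ).coeFn_holder (r := 2) F ξ

theorem compOp_mul_compOp : compOp hθ * compOp hη = compOp (hη.comp hθ) :=
  ContinuousLinearMap.ext fun ξ => (Lp.compMeasurePreserving_comp_apply ξ hη hθ).symm

theorem compOp_mul_compOp_eq (h : ∀ z, η (θ z) = η' (θ' z)) :
    compOp hθ * compOp hη = compOp hθ' * compOp hη' := by
  have hcomp : η ∘ θ = η' ∘ θ' := funext h
  simp only [compOp_mul_compOp, hcomp]

theorem isSelfAdjoint_compOp (h : Function.Involutive θ) : IsSelfAdjoint (compOp hθ) := by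
  rw [ContinuousLinearMap.isSelfAdjoint_iff_isSymmetric]
  intro ξ ζ
  have hsq : compOp hθ (compOp hθ ζ) = ζ := by
    have hid : θ ∘ θ = id := h.comp_self
    have := congrArg (· ζ) (compOp_mul_compOp hθ hθ)
    simp only [hid] at this
    exact this.trans (Lp.compMeasurePreserving_id_apply ζ)
  calc inner ℂ (compOp hθ ξ) ζ
      = inner ℂ (compOp hθ ξ) (compOp hθ (compOp hθ ζ)) := by rw [hsq]
    _ = inner ℂ ξ (compOp hθ ζ) :=
        (Lp.compMeasurePreservingₗᵢ ℂ θ hθ (p := 2) (E := ℂ)).inner_map_map _ _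

theorem commute_compOp_mulOp {F : Lp ℂ ∞ m} (h : ∀ᵐ z ∂m, F (θ z) = F z) :
    Commute (compOp hθ) (mulOp F) := by
  ext1 ξ
  apply Lp.ext
  change (compOp hθ (mulOp F ξ) : Ω → ℂ) =ᵐ[m] (mulOp F (compOp hθ ξ) : Ω → ℂ)
  filter_upwards [coeFn_compOp hθ (mulOp F ξ), hθ.quasiMeasurePreserving.ae (coeFn_mulOp F ξ),
    coeFn_mulOp F (compOp hθ ξ), coeFn_compOp hθ ξ, h] with z h1 h2 h3 h4 h5
  rw [h1, h2, h3, h4, h5]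

theorem ae_add_eq_of_commute_add {F : Lp ℂ ∞ m}
    (h : Commute (compOp hθ + compOp hη) (mulOp F)) (ξ : Lp ℂ 2 m) :
    ∀ᵐ z ∂m, F (θ z) * ξ (θ z) + F (η z) * ξ (η z) = F z * (ξ (θ z) + ξ (η z)) := by
  have hξ : compOp hθ (mulOp F ξ) + compOp hη (mulOp F ξ) =
      mulOp F (compOp hθ ξ + compOp hη ξ) := congrArg (· ξ) h.eq
  have hmul := coeFn_mulOp F ξ
  filter_upwards [Lp.coeFn_add (compOp hθ (mulOp F ξ)) (compOp hη (mulOp F ξ)),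
    coeFn_mulOp F (compOp hθ ξ + compOp hη ξ), Lp.coeFn_add (compOp hθ ξ) (compOp hη ξ),
    coeFn_compOp hθ (mulOp F ξ), coeFn_compOp hη (mulOp F ξ), coeFn_compOp hθ ξ,
    coeFn_compOp hη ξ, hθ.quasiMeasurePreserving.ae hmul, hη.quasiMeasurePreserving.ae hmul]
    with z h1 h2 h3 h4 h5 h6 h7 h8 h9
  rw [hξ, h2, h3] at h1
  simp only [Pi.add_apply, h4, h5, h6, h7, h8, h9] at h1
  exact h1.symm

section Partition

variable {ι : Type*} [Countable ι] {κ : Ω → ι}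

theorem ae_eq_comp_of_compOp_eq (hκ : ∀ i, MeasurableSet (κ ⁻¹' {i}))
    (hfin : ∀ i, m (κ ⁻¹' {i}) ≠ ∞) (h : compOp hθ = compOp hη) :
    ∀ᵐ z ∂m, κ (θ z) = κ (η z) := by
  have hfibre (i : ι) : ∀ᵐ z ∂m, κ (θ z) = i → κ (η z) = i := by
    let ξ : Lp ℂ 2 m := indicatorConstLp 2 (hκ i) (hfin i) 1
    have hξ : ξ =ᵐ[m] (κ ⁻¹' {i}).indicator fun _ => 1 := indicatorConstLp_coeFn
    filter_upwards [coeFn_compOp hθ ξ, coeFn_compOp hη ξ, hθ.quasiMeasurePreserving.ae hξ,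
      hη.quasiMeasurePreserving.ae hξ] with z h1 h2 h3 h4 hz
    rw [h, h2, h3, h4] at h1
    by_contra hne
    simp [hz, hne] at h1
  filter_upwards [ae_all_iff.2 hfibre] with z hz using (hz _ rfl).symm

/-- Testing the commutation relation on the indicator function of a fibre of `κ` isolates the
contribution of `θ`, because `η` leaves the fibre. -/
theorem ae_comp_eq_of_commute_add (hκ : ∀ i, MeasurableSet (κ ⁻¹' {i}))
    (hfin : ∀ i, m (κ ⁻¹' {i}) ≠ ∞) (hκθ : ∀ z, κ (θ z) = κ z)
    (hκη : ∀ z, θ z = z ∨ κ (η z) ≠ κ z) {F : Lp ℂ ∞ m}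
    (h : Commute (compOp hθ + compOp hη) (mulOp F)) : ∀ᵐ z ∂m, F (θ z) = F z := by
  have hfibre (i : ι) : ∀ᵐ z ∂m, κ z = i → F (θ z) = F z := by
    let ξ : Lp ℂ 2 m := indicatorConstLp 2 (hκ i) (hfin i) 1
    have hξ : ξ =ᵐ[m] (κ ⁻¹' {i}).indicator fun _ => 1 := indicatorConstLp_coeFn
    filter_upwards [ae_add_eq_of_commute_add hθ hη h ξ, hθ.quasiMeasurePreserving.ae hξ,
      hη.quasiMeasurePreserving.ae hξ] with z h1 h2 h3 hz
    obtain hfix | hmove := hκη z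
    · rw [hfix]
    · rw [h2, h3, Set.indicator_of_mem (show θ z ∈ κ ⁻¹' {i} from (hκθ z).trans hz),
        Set.indicator_of_notMem (show η z ∉ κ ⁻¹' {i} from fun h => hmove (h.trans hz.symm))] at h1
      simpa only [mul_one, mul_zero, add_zero] using h1
  filter_upwards [ae_all_iff.2 hfibre] with z hz using hz _ rfl

/-- The indicator function of a measurable set, as an element of `L^∞(Ω, m)`. -/
def indicatorLinfty (m : Measure Ω) {A : Set Ω} (hA : MeasurableSet A) : Lp ℂ ∞ m :=
  ((memLp_top_const (1 : ℂ)).indicator hA).toLp _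

theorem coeFn_indicatorLinfty {A : Set Ω} (hA : MeasurableSet A) :
    indicatorLinfty m hA =ᵐ[m] A.indicator fun _ => 1 :=
  MemLp.coeFn_toLp _

theorem mulOp_indicatorLinfty_mul_compOp {A : Set Ω} (hA : MeasurableSet A)
    (h : Set.EqOn θ η A) :
    mulOp (indicatorLinfty m hA) * compOp hθ = mulOp (indicatorLinfty m hA) * compOp hη := by
  ext1 ξ
  apply Lp.ext
  change (mulOp (indicatorLinfty m hA) (compOp hθ ξ) : Ω → ℂ) =ᵐ[m]
    (mulOp (indicatorLinfty m hA) (compOp hη ξ) : Ω → ℂ)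
  filter_upwards [coeFn_mulOp (indicatorLinfty m hA) (compOp hθ ξ),
    coeFn_mulOp (indicatorLinfty m hA) (compOp hη ξ), coeFn_compOp hθ ξ, coeFn_compOp hη ξ,
    coeFn_indicatorLinfty hA] with z h1 h2 h3 h4 h5
  rw [h1, h2, h3, h4, h5]
  by_cases hz : z ∈ A
  · rw [h hz]
  · simp only [Set.indicator_of_notMem hz, zero_mul]

variable (hκ : ∀ i, MeasurableSet (κ ⁻¹' {i}))

theorem eq_of_forall_mulOp_indicatorLinfty_mul_eq {S T : Lp ℂ 2 m →L[ℂ] Lp ℂ 2 m}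
    (h : ∀ i, mulOp (indicatorLinfty m (hκ i)) * S = mulOp (indicatorLinfty m (hκ i)) * T) :
    S = T := by
  ext1 ξ
  apply Lp.ext
  have hfibre (i : ι) : ∀ᵐ z ∂m, κ z = i → S ξ z = T ξ z := by
    have hξ : mulOp (indicatorLinfty m (hκ i)) (S ξ) = mulOp (indicatorLinfty m (hκ i)) (T ξ) :=
      congrArg (· ξ) (h i)
    filter_upwards [coeFn_mulOp (indicatorLinfty m (hκ i)) (S ξ),
      coeFn_mulOp (indicatorLinfty m (hκ i)) (T ξ), coeFn_indicatorLinfty (hκ i)]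
      with z h1 h2 h3 hz
    rw [hξ, h2, h3, Set.indicator_of_mem (show z ∈ κ ⁻¹' {i} from hz)] at h1
    simpa only [one_mul] using h1.symm
  filter_upwards [ae_all_iff.2 hfibre] with z hz using hz _ rfl

theorem mem_of_forall_mulOp_indicatorLinfty_mul_mem {M : VonNeumannAlgebra (Lp ℂ 2 m)}
    {T : Lp ℂ 2 m →L[ℂ] Lp ℂ 2 m} (hM : ∀ i, mulOp (indicatorLinfty m (hκ i)) ∈ M)
    (hT : ∀ i, mulOp (indicatorLinfty m (hκ i)) * T ∈ M) : T ∈ M := by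
  rw [← M.commutant_commutant, VonNeumannAlgebra.mem_commutant_iff]
  intro V hV
  rw [VonNeumannAlgebra.mem_commutant_iff] at hV
  refine eq_of_forall_mulOp_indicatorLinfty_mul_eq hκ fun i => ?_
  rw [← mul_assoc, hV _ (hM i), mul_assoc, ← hV _ (hT i), mul_assoc]

end Partition

end Operators

/-! ### Operators on `L²(Γ × Y)` -/

theorem measurePreserving_count {α β : Type*} [MeasurableSpace α] [DiscreteMeasurableSpace α]
    [MeasurableSpace β] (e : α ≃ β) : MeasurePreserving e Measure.count Measure.count := by
  refine ⟨.of_discrete, Measure.ext fun A hA => ?_⟩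
  rw [Measure.map_apply .of_discrete hA, Measure.count_apply hA,
    Measure.count_apply .of_discrete, Set.encard_preimage_of_bijective e.bijective]

section Fibred

variable {Γ : Type u} [MeasurableSpace Γ] [DiscreteMeasurableSpace Γ] [Countable Γ]
  {Y : Type v} [MeasurableSpace Y] {ν : Measure Y}

variable (Γ ν) in
/-- The measure on `Γ × Y` underlying `HilbertSpace Γ ν`. -/
abbrev countProd : Measure (Γ × Y) := (Measure.count : Measure Γ).prod ν

theorem measurableSet_fst_preimage (t : Γ) :
    MeasurableSet ((Prod.fst : Γ × Y → Γ) ⁻¹' {t}) :=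
  measurable_fst (measurableSet_singleton t)

theorem countProd_fst_preimage_ne_top [IsFiniteMeasure ν] (t : Γ) :
    countProd Γ ν (Prod.fst ⁻¹' {t}) ≠ ∞ := by
  rw [← Set.prod_univ, Measure.prod_prod, Measure.count_singleton, one_mul]
  exact measure_ne_top ν _

theorem measurePreserving_fibred [SFinite ν] {f : Y → Y} (hf : MeasurePreserving f ν ν)
    (e : Y → Equiv.Perm Γ) (he : ∀ t, Measurable fun y => e y t) :
    MeasurePreserving (fun z : Γ × Y => (e z.2 z.1, f z.2)) (countProd Γ ν) (countProd Γ ν) := by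
  have hskew : MeasurePreserving (fun p : Y × Γ => (f p.1, e p.1 p.2))
      (ν.prod Measure.count) (ν.prod Measure.count) :=
    hf.skew_product (measurable_from_prod_countable_left he)
      (ae_of_all _ fun y => (measurePreserving_count (e y)).map_eq)
  exact (Measure.measurePreserving_swap.comp hskew).comp Measure.measurePreserving_swap

variable [Group Γ] [SFinite ν] {θ : Γ × Y → Γ × Y}
  (hθ : MeasurePreserving θ (countProd Γ ν) (countProd Γ ν))

theorem commute_compOp_translationOp
    (h : ∀ (r : Γ) (z : Γ × Y), θ (r * z.1, z.2) = (r * (θ z).1, (θ z).2)) (r : Γ) :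
    Commute (compOp hθ) (translationOp ν r) :=
  compOp_mul_compOp_eq hθ (measurePreserving_translate ν r) (measurePreserving_translate ν r) hθ
    fun z => (h r⁻¹ z).symm

variable [MulAction Γ Y]

theorem quasiMeasurePreserving_smul (hν : IsNonsingular Γ ν) :
    Measure.QuasiMeasurePreserving (fun z : Γ × Y => z.1 • z.2) (countProd Γ ν) ν :=
  QuasiMeasurePreserving.prod_of_right
    (measurable_from_prod_countable_right fun t => (hν t).measurable) (ae_of_all _ hν)

theorem commute_compOp_coefficientOps_pullbackLinfty {X : Type*} [MeasurableSpace X]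
    {μ : Measure X} {π : Y → X} (hν : IsNonsingular Γ ν)
    (h : ∀ z, π ((θ z).1 • (θ z).2) = π (z.1 • z.2)) {S : HilbertSpace Γ ν →L[ℂ] HilbertSpace Γ ν}
    (hS : S ∈ coefficientOps Γ ν (pullbackLinfty ν μ π)) : Commute (compOp hθ) S := by
  obtain ⟨g, ⟨f, hf⟩, G, hG, rfl⟩ := hS
  have hGf : ∀ᵐ z ∂countProd Γ ν, G z = f (π (z.1 • z.2)) := by
    filter_upwards [hG, (quasiMeasurePreserving_smul hν).ae hf] with z h1 h2
    rw [h1, h2]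
  refine commute_compOp_mulOp hθ ?_
  filter_upwards [hGf, hθ.quasiMeasurePreserving.ae hGf] with z h1 h2
  rw [h1, h2, h]

theorem coefficientOps_subset_crossedProduct (N : Set (Lp ℂ ∞ ν)) :
    coefficientOps Γ ν N ⊆ crossedProduct Γ ν N :=
  Set.subset_union_left.trans (subset_generated _)

theorem translationOp_mem_crossedProduct (N : Set (Lp ℂ ∞ ν)) (r : Γ) :
    translationOp ν r ∈ crossedProduct Γ ν N :=
  subset_generated _ (Or.inr ⟨r, rfl⟩)

theorem crossedProduct_mono {N N' : Set (Lp ℂ ∞ ν)} (h : N ⊆ N') :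
    crossedProduct Γ ν N ≤ crossedProduct Γ ν N' := by
  refine generated_le ?_
  rintro x (⟨g, hg, F, hF, rfl⟩ | ⟨r, rfl⟩)
  · exact coefficientOps_subset_crossedProduct N' ⟨g, h hg, F, hF, rfl⟩
  · exact translationOp_mem_crossedProduct N' r

theorem mulOp_indicatorLinfty_smul_preimage_mem_crossedProduct (hν : IsNonsingular Γ ν)
    {B : Set Y} (hB : MeasurableSet B)
    (hA : MeasurableSet ((fun z : Γ × Y => z.1 • z.2) ⁻¹' B)) :
    mulOp (indicatorLinfty (countProd Γ ν) hA) ∈ crossedProduct Γ ν Set.univ := by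
  refine coefficientOps_subset_crossedProduct _ ⟨indicatorLinfty ν hB, trivial, _, ?_, rfl⟩
  filter_upwards [coeFn_indicatorLinfty (m := countProd Γ ν) hA,
    (quasiMeasurePreserving_smul hν).ae (coeFn_indicatorLinfty hB)] with z h1 h2
  rw [h1, h2]
  rfl

/-- The operators in question are the elements of the full group: on the set where the cocycle `c`
takes the value `γ`, they agree with `u_γ⁻¹`. -/
theorem compOp_mem_crossedProduct (hν : IsNonsingular Γ ν) {c : Y → Γ} (hc : Measurable c)
    (hφ : MeasurePreserving (fun z : Γ × Y => (c (z.1 • z.2) * z.1, z.2))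
      (countProd Γ ν) (countProd Γ ν)) :
    compOp hφ ∈ crossedProduct Γ ν Set.univ := by
  have hB (γ : Γ) : MeasurableSet (c ⁻¹' {γ}) := hc (measurableSet_singleton γ)
  have hA (γ : Γ) : MeasurableSet ((fun z : Γ × Y => c (z.1 • z.2)) ⁻¹' {γ}) :=
    (quasiMeasurePreserving_smul hν).measurable (hB γ)
  have hmem (γ : Γ) := mulOp_indicatorLinfty_smul_preimage_mem_crossedProduct hν (hB γ) (hA γ)
  refine mem_of_forall_mulOp_indicatorLinfty_mul_mem hA hmem fun γ => ?_
  have hcut := mulOp_indicatorLinfty_mul_compOp hφ (measurePreserving_translate ν γ⁻¹) (hA γ)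
    fun z (hz : c (z.1 • z.2) = γ) => by simp only [hz, inv_inv]
  rw [hcut]
  exact mul_mem (hmem γ) (translationOp_mem_crossedProduct _ γ⁻¹)

theorem ne_crossedProduct_of_commute {M : VonNeumannAlgebra (HilbertSpace Γ ν)}
    {A T V : HilbertSpace Γ ν →L[ℂ] HilbertSpace Γ ν} (hA : ∀ S ∈ M, Commute A S)
    (hAT : ∀ G : Lp ℂ ∞ (countProd Γ ν), Commute A (mulOp G) → Commute T (mulOp G))
    (hT : IsSelfAdjoint T) (hTu : ∀ r, Commute T (translationOp ν r))
    (hV : V ∈ M) (hTV : ¬ Commute T V) (N : Set (Lp ℂ ∞ ν)) : M ≠ crossedProduct Γ ν N := by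
  rintro rfl
  refine hTV (commute_of_mem_generated hT ?_ hV)
  rintro _ (hS | ⟨r, rfl⟩)
  · obtain ⟨g, -, G, -, rfl⟩ := id hS
    exact hAT G (hA _ (coefficientOps_subset_crossedProduct N hS))
  · exact hTu r

end Fibred

/-! ### A free extension of a non-singular action -/

section Products

variable {Γ : Type u} [Group Γ] {X : Type v} {Y : Type w} [MeasurableSpace X] [MeasurableSpace Y]
  [MulAction Γ X] [MulAction Γ Y] {μ : Measure X} {ν : Measure Y}

theorem IsNonsingular.prod [SFinite μ] [SFinite ν] (hμ : IsNonsingular Γ μ)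
    (hν : IsNonsingular Γ ν) : IsNonsingular Γ (μ.prod ν) :=
  fun g => QuasiMeasurePreserving.prodMap (hμ g) (hν g)

theorem IsEssentiallyFree.prod_right (hμ : IsEssentiallyFree Γ μ) :
    IsEssentiallyFree Γ (μ.prod ν) := fun g hg =>
  measure_mono_null (fun _ h => congrArg Prod.fst h)
    (Measure.quasiMeasurePreserving_fst.preimage_null (hμ g hg))

theorem IsEssentiallyFree.prod_left (hν : IsEssentiallyFree Γ ν) :
    IsEssentiallyFree Γ (μ.prod ν) := fun g hg =>
  measure_mono_null (fun _ h => congrArg Prod.snd h)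
    (Measure.quasiMeasurePreserving_snd.preimage_null (hν g hg))

theorem IsFactorMap.comp {W : Type*} [MeasurableSpace W] [MulAction Γ W] {ω : Measure W}
    {π : Y → X} {p : W → Y} (hπ : IsFactorMap Γ π ν μ) (hp : IsFactorMap Γ p ω ν) :
    IsFactorMap Γ (π ∘ p) ω μ where
  measurable := hπ.measurable.comp hp.measurable
  map_absolutelyContinuous := by
    rw [← Measure.map_map hπ.measurable hp.measurable]
    exact (hp.map_absolutelyContinuous.map hπ.measurable).trans hπ.map_absolutelyContinuous
  absolutelyContinuous_map := by
    rw [← Measure.map_map hπ.measurable hp.measurable]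
    exact hπ.absolutelyContinuous_map.trans (hp.absolutelyContinuous_map.map hπ.measurable)
  equivariant g := by
    have hp' : Measure.QuasiMeasurePreserving p ω ν := ⟨hp.measurable, hp.map_absolutelyContinuous⟩
    filter_upwards [hp.equivariant g, hp'.ae (hπ.equivariant g)] with z h1 h2
    rw [Function.comp_apply, h1, h2, Function.comp_apply]

theorem isFactorMap_fst [IsProbabilityMeasure ν] :
    IsFactorMap Γ (Prod.fst : X × Y → X) (μ.prod ν) μ where
  measurable := measurable_fst
  map_absolutelyContinuous := Measure.quasiMeasurePreserving_fst.absolutelyContinuous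
  absolutelyContinuous_map := by simp [Measure.map_fst_prod, Measure.AbsolutelyContinuous.rfl]
  equivariant _ := ae_of_all _ fun _ => rfl

end Products

theorem exists_perm_mul_right_inv {G : Type*} [Group G] (H : Subgroup G) [IsMulCommutative H] :
    ∃ J : Equiv.Perm G, ∀ z, ∀ h ∈ H, J (z * h) = J z * h⁻¹ := by
  obtain ⟨S, hS, -⟩ := H.exists_isComplement_left 1
  let J : Equiv.Perm G :=
    (hS.equiv.trans ((Equiv.refl S).prodCongr (Equiv.inv H))).trans hS.equiv.symm
  have hJ (z : G) : J z = (hS.equiv z).1 * ((hS.equiv z).2 : G)⁻¹ := by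
    simp [J, hS.equiv_symm_apply]
  refine ⟨J, fun z h hh => ?_⟩
  rw [hJ, hJ, hS.equiv_mul_right_of_mem hh, mul_assoc, ← mul_inv_rev,
    mul_comm' (hS.equiv z).2 ⟨h, hh⟩]
  rfl

section Extension

variable {Γ : Type u} [Group Γ] {X : Type v}

/-- The trivial action of `Γ` on the two sheets of the extension. -/
abbrev sheetAction : MulAction Γ Bool where
  smul _ i := i
  one_smul _ := rfl
  mul_smul _ _ _ := rfl

attribute [local instance] sheetAction

variable (Γ X) in
/-- The underlying space of the free extension of an action of `Γ` on `X`. Its action of `Γ` is the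
diagonal one, where `Γ` acts on itself by left translation and trivially on the two sheets. -/
abbrev Extension : Type (max u v) := (X × Γ) × Bool

open Classical in
/-- The exchange of the two sheets over the set `D`. -/
def toggle {B : Type*} (D : Set B) (z : B × Bool) : B × Bool :=
  (z.1, if z.1 ∈ D then !z.2 else z.2)

theorem involutive_toggle {B : Type*} (D : Set B) : Function.Involutive (toggle D) := by
  rintro ⟨b, i⟩
  by_cases h : b ∈ D <;> simp [toggle, h]

section Maps

variable [MulAction Γ X]

variable (X) in
/-- The set over which the flips below exchange the sheets: the points `(x, y)` such that the
conjugate `y s y⁻¹` fixes `x`. Conjugating by `y` makes it invariant under the diagonal action. -/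
def conjFixedPoints (s : Γ) : Set (X × Γ) :=
  {b | (b.2 * s * b.2⁻¹) • b.1 = b.1}

open Classical in
/-- The group element by which `twistedFlip` translates. -/
def twist (s : Γ) (ω : Extension Γ X) : Γ :=
  if ω.1 ∈ conjFixedPoints X s then ω.1.2 * (if ω.2 then s⁻¹ else s) * ω.1.2⁻¹ else 1

/-- The sheet exchange over `conjFixedPoints X s`, acting on `Γ × Y` fibre by fibre. -/
def sheetFlip (s : Γ) (z : Γ × Extension Γ X) : Γ × Extension Γ X :=
  (z.1, toggle (conjFixedPoints X s) z.2)

/-- The sheet exchange over `conjFixedPoints X s`, combined with right translation by `twist`. -/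
def twistedFlip (s : Γ) (z : Γ × Extension Γ X) : Γ × Extension Γ X :=
  (z.1 * twist s z.2, toggle (conjFixedPoints X s) z.2)

variable {s : Γ} {J : Equiv.Perm Γ}

theorem conj_inv_smul_eq_iff {b : X × Γ} :
    (b.2 * s⁻¹ * b.2⁻¹) • b.1 = b.1 ↔ b ∈ conjFixedPoints X s := by
  rw [show b.2 * s⁻¹ * b.2⁻¹ = (b.2 * s * b.2⁻¹)⁻¹ by group, inv_smul_eq_iff, eq_comm]
  rfl

theorem twist_smul (ω : Extension Γ X) : twist s ω • ω.1.1 = ω.1.1 := by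
  rw [twist]
  split_ifs with hω hi
  · exact conj_inv_smul_eq_iff.2 hω
  · exact hω
  · exact one_smul Γ ω.1.1

theorem involutive_sheetFlip : Function.Involutive (sheetFlip (X := X) s) := fun z =>
  Prod.ext rfl (involutive_toggle _ z.2)

theorem involutive_twistedFlip : Function.Involutive (twistedFlip (X := X) s) := by
  rintro ⟨t, ⟨x, y⟩, i⟩
  by_cases h : (x, y) ∈ conjFixedPoints X s <;> cases i <;>
    simp [twistedFlip, twist, toggle, h, mul_assoc]

/-- The cocycle of the element of the full group which conjugates `sheetFlip` to `twistedFlip`. -/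
def cocycle (s : Γ) (J : Equiv.Perm Γ) (ω : Extension Γ X) : Γ :=
  J ω.1.2 * (if ω.2 then s else 1) * ω.1.2⁻¹

/-- The transformation of `Γ × Y` implementing the element of the full group of the extension with
cocycle `cocycle s J`. -/
def conjugator (s : Γ) (J : Equiv.Perm Γ) (z : Γ × Extension Γ X) : Γ × Extension Γ X :=
  (cocycle s J (z.1 • z.2) * z.1, z.2)

theorem conjugator_apply (z : Γ × Extension Γ X) :
    conjugator s J z = (J (z.1 * z.2.1.2) * ((if z.2.2 then s else 1) * z.2.1.2⁻¹), z.2) := by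
  change (J (z.1 * z.2.1.2) * (if z.2.2 then s else 1) * (z.1 * z.2.1.2)⁻¹ * z.1, z.2) = _
  simp only [mul_inv_rev, mul_assoc, inv_mul_cancel, mul_one]

theorem conjugator_sheetFlip (z : Γ × Extension Γ X) :
    conjugator s J (sheetFlip s z) = twistedFlip s (conjugator s J z) := by
  obtain ⟨t, ⟨x, y⟩, i⟩ := z
  by_cases h : (x, y) ∈ conjFixedPoints X s <;> cases i <;>
    simp [sheetFlip, twistedFlip, twist, toggle, conjugator_apply, h, mul_assoc]

theorem conjugator_twistedFlip (hJ : ∀ z, ∀ h ∈ Subgroup.zpowers s, J (z * h) = J z * h⁻¹)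
    (z : Γ × Extension Γ X) :
    conjugator s J (twistedFlip s z) = sheetFlip s (conjugator s J z) := by
  have hJs (z : Γ) : J (z * s) = J z * s⁻¹ := hJ z s (Subgroup.mem_zpowers s)
  have hJs' (z : Γ) : J (z * s⁻¹) = J z * s := by
    simpa using hJ z s⁻¹ (inv_mem (Subgroup.mem_zpowers s))
  obtain ⟨t, ⟨x, y⟩, i⟩ := z
  by_cases h : (x, y) ∈ conjFixedPoints X s <;> cases i <;>
    simp [sheetFlip, twistedFlip, twist, toggle, conjugator_apply, h, ← mul_assoc, hJs, hJs']

theorem fst_conjugator_sheetFlip_ne (hs : s ≠ 1) {z : Γ × Extension Γ X}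
    (hz : z.2.1 ∈ conjFixedPoints X s) :
    (conjugator s J (sheetFlip s z)).1 ≠ (sheetFlip s (conjugator s J z)).1 := by
  obtain ⟨t, b, i⟩ := z
  cases i <;> simp_all [sheetFlip, toggle, conjugator_apply]

theorem sheetFlip_eq_or_fst_twistedFlip_ne (hs : s ≠ 1) (z : Γ × Extension Γ X) :
    sheetFlip s z = z ∨ (twistedFlip s z).1 ≠ z.1 := by
  obtain ⟨t, b, i⟩ := z
  by_cases h : b ∈ conjFixedPoints X s
  · right
    cases i <;> simp [twistedFlip, twist, h, hs, mul_inv_eq_one]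
  · left
    simp [sheetFlip, toggle, h]

end Maps

section Measure

theorem isEssentiallyFree_self [MeasurableSpace Γ] (ν : Measure Γ) :
    IsEssentiallyFree Γ ν := fun g hg => by
  simp [hg]

theorem measurePreserving_uniformOn_univ {α : Type*} [MeasurableSpace α]
    [DiscreteMeasurableSpace α] (e : Equiv.Perm α) :
    MeasurePreserving e (ProbabilityTheory.uniformOn Set.univ)
      (ProbabilityTheory.uniformOn Set.univ) := by
  have h := (measurePreserving_count e).smul_measure (Measure.count (Set.univ : Set α))⁻¹
  rwa [ProbabilityTheory.uniformOn, ProbabilityTheory.cond, Measure.restrict_univ]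

theorem measurePreserving_toggle {B : Type*} [MeasurableSpace B] {ν : Measure B} [SFinite ν]
    {D : Set B} (hD : MeasurableSet D) :
    MeasurePreserving (toggle D) (ν.prod (ProbabilityTheory.uniformOn Set.univ))
      (ν.prod (ProbabilityTheory.uniformOn Set.univ)) := by
  classical
  refine (MeasurePreserving.id ν).skew_product (g := fun b i => if b ∈ D then !i else i) ?_
    (ae_of_all _ fun b => ?_)
  · exact measurable_from_prod_countable_left fun i =>
      Measurable.ite hD (measurable_const (a := !i)) (measurable_const (a := i))
  · by_cases h : b ∈ D
    · simp only [h, if_true]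
      exact (measurePreserving_uniformOn_univ Equiv.boolNot).map_eq
    · simp only [h, if_false]
      exact Measure.map_id

variable [MeasurableSpace Γ] [MeasurableSpace X] {μ : Measure X}

variable (Γ) in
/-- The measure on the extension of `(X, μ)`: on `Γ` it is a probability measure equivalent to the
counting measure, on the sheets it is uniform. -/
abbrev extensionMeasure [Countable Γ] (μ : Measure X) :
    Measure (Extension Γ X) :=
  (μ.prod (Measure.count : Measure Γ).toFinite).prod (ProbabilityTheory.uniformOn Set.univ)

instance [Countable Γ] :
    IsProbabilityMeasure (Measure.count : Measure Γ).toFinite := by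
  have : NeZero (Measure.count : Measure Γ) := ⟨by simp⟩
  infer_instance

variable [Countable Γ]

theorem isEssentiallyFree_extensionMeasure [MulAction Γ X] :
    IsEssentiallyFree Γ (extensionMeasure Γ μ) :=
  (isEssentiallyFree_self _).prod_left.prod_right

theorem isFactorMap_extension [MulAction Γ X] :
    IsFactorMap Γ (fun ω : Extension Γ X => ω.1.1) (extensionMeasure Γ μ) μ :=
  isFactorMap_fst.comp isFactorMap_fst

variable [DiscreteMeasurableSpace Γ] {s : Γ} {J : Equiv.Perm Γ}

theorem measurable_cocycle : Measurable (cocycle (X := X) s J) :=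
  (Measurable.of_discrete (f := fun p : Γ × Bool =>
    J p.1 * (if p.2 then s else 1) * p.1⁻¹)).comp (measurable_fst.snd.prodMk measurable_snd)

variable [MulAction Γ X]

theorem isNonsingular_toFinite_count : IsNonsingular Γ (Measure.count : Measure Γ).toFinite :=
  fun g => (measurePreserving_mul_left Measure.count g).quasiMeasurePreserving.mono
    (toFinite_absolutelyContinuous _) (absolutelyContinuous_toFinite _)

theorem isNonsingular_extensionMeasure [SFinite μ] (hμ : IsNonsingular Γ μ) :
    IsNonsingular Γ (extensionMeasure Γ μ) :=
  (hμ.prod isNonsingular_toFinite_count).prod fun _ => .id _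

theorem measurableSet_conjFixedPoints [MeasurableEq X] (hμ : IsNonsingular Γ μ) :
    MeasurableSet (conjFixedPoints X s) :=
  measurableSet_eq_fun
    (measurable_from_prod_countable_left fun y => (hμ (y * s * y⁻¹)).measurable) measurable_fst

theorem extensionMeasure_conjFixedPoints_ne_zero (h : μ {x | s • x = x} ≠ 0) :
    extensionMeasure Γ μ (Prod.fst ⁻¹' conjFixedPoints X s) ≠ 0 := by
  have hsub : ({x : X | s • x = x} ×ˢ ({1} : Set Γ)) ×ˢ (Set.univ : Set Bool) ⊆
      Prod.fst ⁻¹' conjFixedPoints X s := by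
    rintro ⟨⟨x, y⟩, i⟩ ⟨⟨hx, rfl⟩, -⟩
    simpa [conjFixedPoints] using hx
  have hone : (Measure.count : Measure Γ).toFinite {1} ≠ 0 := fun h0 => by
    simpa using absolutelyContinuous_toFinite _ h0
  refine fun h0 => h ?_
  have hnull := measure_mono_null hsub h0
  rw [Measure.prod_prod, Measure.prod_prod, measure_univ, mul_one] at hnull
  exact (mul_eq_zero.1 hnull).resolve_right hone

theorem measurePreserving_sheetFlip [MeasurableEq X] [SFinite μ] (hμ : IsNonsingular Γ μ) :
    MeasurePreserving (sheetFlip s) (countProd Γ (extensionMeasure Γ μ))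
      (countProd Γ (extensionMeasure Γ μ)) :=
  (MeasurePreserving.id _).prod (measurePreserving_toggle (measurableSet_conjFixedPoints hμ))

theorem measurable_twist [MeasurableEq X] (hμ : IsNonsingular Γ μ) :
    Measurable (twist (X := X) s) := by
  classical
  refine Measurable.ite (measurable_fst (measurableSet_conjFixedPoints hμ)) ?_ measurable_const
  exact (Measurable.of_discrete (f := fun p : Γ × Bool =>
    p.1 * (if p.2 then s⁻¹ else s) * p.1⁻¹)).comp (measurable_fst.snd.prodMk measurable_snd)

theorem measurePreserving_twistedFlip [MeasurableEq X] [SFinite μ] (hμ : IsNonsingular Γ μ) :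
    MeasurePreserving (twistedFlip s) (countProd Γ (extensionMeasure Γ μ))
      (countProd Γ (extensionMeasure Γ μ)) :=
  measurePreserving_fibred (measurePreserving_toggle (measurableSet_conjFixedPoints hμ))
    (fun ω => Equiv.mulRight (twist s ω)) fun _ => measurable_const.mul (measurable_twist hμ)

theorem measurePreserving_conjugator [SFinite μ] :
    MeasurePreserving (conjugator s J) (countProd Γ (extensionMeasure Γ μ))
      (countProd Γ (extensionMeasure Γ μ)) := by
  let e (p : Γ × Bool) : Equiv.Perm Γ := ((Equiv.mulRight p.1).trans J).trans
    (Equiv.mulRight ((if p.2 then s else 1) * p.1⁻¹))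
  have h := measurePreserving_fibred (MeasurePreserving.id (extensionMeasure Γ μ))
    (fun ω => e (ω.1.2, ω.2)) fun t => (Measurable.of_discrete (f := fun p => e p t)).comp
      (measurable_fst.snd.prodMk measurable_snd)
  rwa [funext conjugator_apply]

variable (μ s J) in
/-- The von Neumann algebra generated by `L^∞(X) ⋊ Γ` and the unitary of the full group given by
`conjugator s J`. -/
def intermediateAlgebra [SFinite μ] : VonNeumannAlgebra (HilbertSpace Γ (extensionMeasure Γ μ)) :=
  generated (insert (compOp (measurePreserving_conjugator (s := s) (J := J)))
    (coefficientOps Γ (extensionMeasure Γ μ)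
      (pullbackLinfty (extensionMeasure Γ μ) μ fun ω : Extension Γ X => ω.1.1) ∪
      Set.range (translationOp (extensionMeasure Γ μ))))

theorem crossedProduct_le_intermediateAlgebra [SFinite μ] :
    crossedProduct Γ (extensionMeasure Γ μ)
      (pullbackLinfty (extensionMeasure Γ μ) μ fun ω : Extension Γ X => ω.1.1) ≤
        intermediateAlgebra μ s J :=
  generated_le ((Set.subset_insert _ _).trans (subset_generated _))

theorem intermediateAlgebra_le_crossedProduct [SFinite μ] (hμ : IsNonsingular Γ μ) :
    intermediateAlgebra μ s J ≤ crossedProduct Γ (extensionMeasure Γ μ) Set.univ := by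
  refine generated_le (Set.insert_subset ?_ ?_)
  · exact compOp_mem_crossedProduct (isNonsingular_extensionMeasure hμ) measurable_cocycle _
  · exact subset_generated _ |>.trans (crossedProduct_mono (Set.subset_univ _))

theorem commute_of_mem_intermediateAlgebra [MeasurableEq X] [SFinite μ] (hμ : IsNonsingular Γ μ)
    (hJ : ∀ z, ∀ h ∈ Subgroup.zpowers s, J (z * h) = J z * h⁻¹)
    {S : HilbertSpace Γ (extensionMeasure Γ μ) →L[ℂ] HilbertSpace Γ (extensionMeasure Γ μ)}
    (hS : S ∈ intermediateAlgebra μ s J) :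
    Commute (compOp (measurePreserving_sheetFlip (s := s) hμ) +
      compOp (measurePreserving_twistedFlip (s := s) hμ)) S := by
  have hν := isNonsingular_extensionMeasure hμ
  refine commute_of_mem_generated ((isSelfAdjoint_compOp _ involutive_sheetFlip).add
    (isSelfAdjoint_compOp _ involutive_twistedFlip)) ?_ hS
  rintro _ (rfl | hS | ⟨r, rfl⟩)
  · rw [commute_iff_eq, add_mul, mul_add,
      compOp_mul_compOp_eq _ _ _ (measurePreserving_twistedFlip hμ) conjugator_sheetFlip,
      compOp_mul_compOp_eq _ _ _ (measurePreserving_sheetFlip hμ) (conjugator_twistedFlip hJ),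
      add_comm]
  · refine Commute.add_left
      (commute_compOp_coefficientOps_pullbackLinfty (measurePreserving_sheetFlip hμ) hν
        (fun _ => rfl) hS)
      (commute_compOp_coefficientOps_pullbackLinfty (measurePreserving_twistedFlip hμ) hν
        (fun z => ?_) hS)
    change (z.1 * twist s z.2) • z.2.1.1 = z.1 • z.2.1.1
    rw [mul_smul, twist_smul]
  · exact .add_left (commute_compOp_translationOp _ (fun _ _ => rfl) r)
      (commute_compOp_translationOp _ (fun r z => Prod.ext (mul_assoc r z.1 _) rfl) r)

theorem not_commute_sheetFlip_conjugator [MeasurableEq X] [IsFiniteMeasure μ]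
    (hμ : IsNonsingular Γ μ) (hs : s ≠ 1) (hfix : μ {x | s • x = x} ≠ 0) :
    ¬ Commute (compOp (measurePreserving_sheetFlip (s := s) hμ))
      (compOp (measurePreserving_conjugator (s := s) (J := J))) := by
  intro h
  rw [commute_iff_eq, compOp_mul_compOp, compOp_mul_compOp] at h
  have hfibre := ae_eq_comp_of_compOp_eq _ _ measurableSet_fst_preimage
    countProd_fst_preimage_ne_top h
  have hnull : ∀ᵐ z ∂countProd Γ (extensionMeasure Γ μ), z.2.1 ∉ conjFixedPoints X s := by
    filter_upwards [hfibre] with z hz hmem using fst_conjugator_sheetFlip_ne hs hmem hz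
  have hprod : {z : Γ × Extension Γ X | ¬ z.2.1 ∉ conjFixedPoints X s} =
      Set.univ ×ˢ (Prod.fst ⁻¹' conjFixedPoints X s) := by
    ext z; simp
  rw [ae_iff, hprod, Measure.prod_prod] at hnull
  simp [extensionMeasure_conjFixedPoints_ne_zero hfix] at hnull

theorem intermediateAlgebra_ne_crossedProduct [MeasurableEq X] [IsFiniteMeasure μ]
    (hμ : IsNonsingular Γ μ) (hs : s ≠ 1) (hfix : μ {x | s • x = x} ≠ 0)
    (hJ : ∀ z, ∀ h ∈ Subgroup.zpowers s, J (z * h) = J z * h⁻¹)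
    (N : Set (Lp ℂ ∞ (extensionMeasure Γ μ))) :
    intermediateAlgebra μ s J ≠ crossedProduct Γ (extensionMeasure Γ μ) N := by
  have hT : MeasurePreserving (sheetFlip s) (countProd Γ (extensionMeasure Γ μ))
      (countProd Γ (extensionMeasure Γ μ)) := measurePreserving_sheetFlip hμ
  have hT' : MeasurePreserving (twistedFlip s) (countProd Γ (extensionMeasure Γ μ))
      (countProd Γ (extensionMeasure Γ μ)) := measurePreserving_twistedFlip hμ
  refine ne_crossedProduct_of_commute (A := compOp hT + compOp hT') (T := compOp hT)
    (V := compOp (measurePreserving_conjugator (s := s) (J := J)))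
    (fun _ hS => commute_of_mem_intermediateAlgebra hμ hJ hS) (fun G hG => ?_)
    (isSelfAdjoint_compOp _ involutive_sheetFlip)
    (commute_compOp_translationOp hT fun _ _ => rfl) (subset_generated _ (Set.mem_insert _ _))
    (not_commute_sheetFlip_conjugator hμ hs hfix) N
  exact commute_compOp_mulOp hT (ae_comp_eq_of_commute_add hT hT' measurableSet_fst_preimage
    countProd_fst_preimage_ne_top (fun _ => rfl) (sheetFlip_eq_or_fst_twistedFlip_ne hs) hG)

end Measure

end Extension

end CrossedProduct

end

open CrossedProduct

theorem proposition3p9_general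
    {Γ : Type u} [Group Γ] [Countable Γ] [MeasurableSpace Γ] [DiscreteMeasurableSpace Γ]
    {X : Type v} [MeasurableSpace X] [MeasurableEq X] [MulAction Γ X]
    (μ : Measure X) [IsProbabilityMeasure μ]
    (hα : IsNonsingular Γ μ) (hα_nonfree : ¬ IsEssentiallyFree Γ μ) :
    ∃ (Y : Type (max u v)) (_ : MeasurableSpace Y) (_ : MulAction Γ Y)
      (ν : Measure Y) (_ : IsProbabilityMeasure ν) (π : Y → X),
      (StandardBorelSpace X → StandardBorelSpace Y) ∧
      IsNonsingular Γ ν ∧ IsEssentiallyFree Γ ν ∧ IsFactorMap Γ π ν μ ∧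
      ∃ M : VonNeumannAlgebra (HilbertSpace Γ ν),
        crossedProduct Γ ν (pullbackLinfty ν μ π) ≤ M ∧
        M ≤ crossedProduct Γ ν Set.univ ∧
        ∀ N : Set (Lp ℂ ∞ ν), M ≠ crossedProduct Γ ν N := by
  obtain ⟨s, hs, hfix⟩ : ∃ s : Γ, s ≠ 1 ∧ μ {x : X | s • x = x} ≠ 0 := by
    simpa [IsEssentiallyFree] using hα_nonfree
  obtain ⟨J, hJ⟩ := exists_perm_mul_right_inv (Subgroup.zpowers s)
  let : MulAction Γ Bool := sheetAction
  exact ⟨Extension Γ X, inferInstance, inferInstance, extensionMeasure Γ μ, inferInstance,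
    fun ω => ω.1.1, fun _ => inferInstance, isNonsingular_extensionMeasure hα,
    isEssentiallyFree_extensionMeasure, isFactorMap_extension, intermediateAlgebra μ s J,
    crossedProduct_le_intermediateAlgebra, intermediateAlgebra_le_crossedProduct hα,
    intermediateAlgebra_ne_crossedProduct hα hs hfix hJ⟩

theorem proposition3p9
    {Γ : Type u} [Group Γ] [Countable Γ] [MeasurableSpace Γ] [DiscreteMeasurableSpace Γ]
    {X : Type v} [MeasurableSpace X] [StandardBorelSpace X] [MulAction Γ X]
    (μ : Measure X) [IsProbabilityMeasure μ]
    (hα : IsNonsingular Γ μ) (hα_nonfree : ¬ IsEssentiallyFree Γ μ) :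
    ∃ (Y : Type (max u v)) (_ : MeasurableSpace Y) (_ : StandardBorelSpace Y) (_ : MulAction Γ Y)
      (ν : Measure Y) (_ : IsProbabilityMeasure ν) (π : Y → X),
      IsNonsingular Γ ν ∧ IsEssentiallyFree Γ ν ∧ IsFactorMap Γ π ν μ ∧
      ∃ M : VonNeumannAlgebra (HilbertSpace Γ ν),
        crossedProduct Γ ν (pullbackLinfty ν μ π) ≤ M ∧
        M ≤ crossedProduct Γ ν Set.univ ∧
        ∀ (Z : Type w) [MeasurableSpace Z] [StandardBorelSpace Z] [MulAction Γ Z]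
          (ζ : Measure Z) [IsProbabilityMeasure ζ] (p : Y → Z) (q : Z → X),
          IsNonsingular Γ ζ → IsFactorMap Γ p ν ζ → IsFactorMap Γ q ζ μ →
          (∀ᵐ y ∂ν, q (p y) = π y) →
          M ≠ crossedProduct Γ ν (pullbackLinfty ν ζ p) := by
  obtain ⟨Y, _, _, ν, hν, π, hY, hβ, hfree, hπ, M, hle, hle', hne⟩ :=
    proposition3p9_general μ hα hα_nonfree
  exact ⟨Y, _, hY inferInstance, _, ν, hν, π, hβ, hfree, hπ, M, hle, hle',
    fun Z _ _ _ ζ _ p _ _ _ _ _ => hne (pullbackLinfty ν ζ p)⟩
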